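/- Let $\beta>-1$ and $n\in\{0,1,2,\dots\}$. For $z>0$ consider the generalized Charlier weight $\omega(k)=\dfrac{z^k}{(\beta+1)_k\,k!}$, $k=0,1,2,\dots$, where $(\beta+1)_k$ is the Pochhammer symbol, with moments $\mu_m(z)=\sum_{k\ge0}k^m\omega(k)$. With $\delta_z=z\frac{d}{dz}$, put $\mathcal W_n(\psi)=\det\big[\delta_z^{\,i+j}\psi\big]_{i,j=0}^{n-1}$ (so $\mathcal W_0=1$), and $$\Delta_n(z;\beta)=\Gamma(\beta+1)^n\,\mathcal W_n\big(z^{-\beta/2}I_\beta(2\sqrt z)\big),\qquad S_n(z;\beta)=z\frac{d}{dz}\ln\Delta_n(z;\beta),$$ where $I_\beta(x)=\sum_{k\ge0}\frac{(x/2)^{2k+\beta}}{k!\,\Gamma(\beta+k+1)}$ is the modified Bessel function. Then on $z>0$: (a) all moments converge, and $\Delta_n(z;\beta)=\det[\mu_{i+j}(z)]_{i,j=0}^{n-1}$ is positive and differentiable in $z$ (so that $S_n$ is well defined); (b) $S_n$ is twice differentiable and satisfies $$\Big(z\frac{d^2S_n}{dz^2}\Big)^2=\Big[n-(n+\beta)\frac{dS_n}{dz}\Big]^2-4\frac{dS_n}{dz}\Big(\frac{dS_n}{dz}-1\Big)\Big[z\frac{dS_n}{dz}-S_n+\tfrac12n(n-1)\Big];$$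 (c) a function $S$ on $z>0$ is a twice differentiable solution of the equation in (b) (with $S$ in place of $S_n$) if and only if $$\sigma(z)=S(z)-\tfrac12z-\tfrac14n^2+\tfrac12n(\beta+1)+\tfrac14\beta^2$$ is a twice differentiable solution of the $\mathrm{P}_{\mathrm{III}'}$ $\sigma$-equation $$\Big(z\frac{d^2\sigma}{dz^2}\Big)^2+\Big\{4\Big(\frac{d\sigma}{dz}\Big)^2-1\Big\}\Big(z\frac{d\sigma}{dz}-\sigma\Big)+\theta_0\theta_\infty\frac{d\sigma}{dz}=\tfrac14(\theta_0^2+\theta_\infty^2),\qquad(\theta_0,\theta_\infty)=(n+\beta,n-\beta).$$ In particular $\sigma=S_n-\tfrac12z-\tfrac14n^2+\tfrac12n(\beta+1)+\tfrac14\beta^2$ solves this equation. -/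

import Mathlib

namespace GenCharlier

/-- The modified Bessel function of the first kind
`I_ν(x) = ∑_{k ≥ 0} (x/2)^(2k+ν) / (k! Γ(ν+k+1))`, for real order `ν` and `x > 0`. -/
noncomputable def besselI (ν x : ℝ) : ℝ :=
  ∑' k : ℕ, (x / 2) ^ (2 * (k : ℝ) + ν) / ((k.factorial : ℝ) * Real.Gamma (ν + k + 1))

/-- The Euler operator `δ_z = z d/dz`. -/
noncomputable def euler (f : ℝ → ℝ) : ℝ → ℝ := fun z => z * deriv f z

/-- The Wronskian-type Hankel determinant `𝒲_n(ψ) = det (δ_z^{i+j} ψ)_{i,j=0}^{n-1}`;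
`𝒲_0(ψ) = 1`. -/
noncomputable def wronskianHankel (n : ℕ) (ψ : ℝ → ℝ) (z : ℝ) : ℝ :=
  (Matrix.of fun i j : Fin n => (euler^[(i : ℕ) + (j : ℕ)] ψ) z).det

/-- The generalized Charlier weight `ω(k) = z^k / ((β+1)_k k!)`, with `(β+1)_k` the
Pochhammer symbol (rising factorial). -/
noncomputable def weight (β z : ℝ) (k : ℕ) : ℝ :=
  z ^ k / ((ascPochhammer ℝ k).eval (β + 1) * (k.factorial : ℝ))

/-- The moments `μ_m(z) = ∑_{k ≥ 0} k^m ω(k)` (with `0^0 = 1`). -/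
noncomputable def moment (β z : ℝ) (m : ℕ) : ℝ :=
  ∑' k : ℕ, (k : ℝ) ^ m * weight β z k

/-- `Δ_n(z;β) = Γ(β+1)^n 𝒲_n(z^{-β/2} I_β(2√z))`. -/
noncomputable def Delta (n : ℕ) (β : ℝ) : ℝ → ℝ := fun z =>
  Real.Gamma (β + 1) ^ n *
    wronskianHankel n (fun w => w ^ (-β / 2) * besselI β (2 * Real.sqrt w)) z

/-- `S_n(z;β) = z d/dz ln Δ_n(z;β)`. -/
noncomputable def S (n : ℕ) (β : ℝ) : ℝ → ℝ :=
  euler fun z => Real.log (Delta n β z)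

/-- `f` is twice differentiable on `(0,∞)`. -/
def TwiceDiff (f : ℝ → ℝ) : Prop :=
  ∀ z : ℝ, 0 < z → DifferentiableAt ℝ f z ∧ DifferentiableAt ℝ (deriv f) z

/-- `f` is a twice differentiable solution on `(0,∞)` of
`(z f'')² = [n - (n+β) f']² - 4 f' (f' - 1) [z f' - f + n(n-1)/2]`. -/
def SolvesSEquation (n : ℕ) (β : ℝ) (f : ℝ → ℝ) : Prop :=
  TwiceDiff f ∧ ∀ z : ℝ, 0 < z →
    (z * deriv (deriv f) z) ^ 2 =
      ((n : ℝ) - (n + β) * deriv f z) ^ 2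
        - 4 * deriv f z * (deriv f z - 1)
          * (z * deriv f z - f z + (n : ℝ) * ((n : ℝ) - 1) / 2)

/-- `σ` is a twice differentiable solution on `(0,∞)` of the P_III' σ-equation
`(t σ'')² + (4 σ'² - 1)(t σ' - σ) + θ₀ θ_∞ σ' = (θ₀² + θ_∞²)/4`. -/
def SolvesPIIIPrimeSigma (θ₀ θinf : ℝ) (σ : ℝ → ℝ) : Prop :=
  TwiceDiff σ ∧ ∀ t : ℝ, 0 < t →
    (t * deriv (deriv σ) t) ^ 2
        + (4 * deriv σ t ^ 2 - 1) * (t * deriv σ t - σ t)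
        + θ₀ * θinf * deriv σ t = (θ₀ ^ 2 + θinf ^ 2) / 4

/-- The affine shift `σ(z) = f(z) - z/2 - n²/4 + n(β+1)/2 + β²/4`. -/
noncomputable def shift (n : ℕ) (β : ℝ) (f : ℝ → ℝ) : ℝ → ℝ := fun z =>
  f z - z / 2 - (n : ℝ) ^ 2 / 4 + (n : ℝ) * (β + 1) / 2 + β ^ 2 / 4

end GenCharlier

/-!
Fix `z > 0` and let `L` be the functional `X ^ m ↦ μ_m(z)`. Since `Γ(β+1) z^{-β/2} I_β(2√z) = μ_0`
and `δ_z μ_m = μ_{m+1}`, the Wronskian `Δ_n` is the Hankel determinant of the moments, and it equals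
`∏_{k<n} h_k`, with `h_k = L(P_k²) > 0` the squared norms of the monic orthogonal polynomials
`x P_n = P_{n+1} + α_n P_n + b_n P_{n-1}` (`det_hankel_eq_prod`).

Differentiating the norms and the orthogonality relations in `z` gives the Toda equations
`δ_z h_n = α_n h_n` and `δ_z ∑_{k<n} α_k = b_n`. Hence `S_n = ∑_{k<n} α_k` and `z S_n' = b_n`
(`hasDerivAt_sqNorm`, `hasDerivAt_sum_recA`).

The weight satisfies `k (k+β) ω(k) = z ω(k-1)`, that is `L[x(x+β) p(x)] = z L[p(x+1)]`. Therefore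
`x (x+β) P_n(x-1)` is orthogonal to all polynomials of degree below `n`, so it is a combination
`P_{n+2} + A P_{n+1} + z P_n`. Comparing coefficients yields two Laguerre–Freud equations
(`laguerreFreud_one`, `laguerreFreud_two`), the second of which involves `S_n`. Together they imply
a third one by induction on `n` (`laguerreFreud_three`), and eliminating `b_{n+1}` leaves a first
integral relating `S_n`, `α_n` and `b_n` (`first_integral`). The first Laguerre–Freud equation turns
`δ_z b_n = b_n (α_n - α_{n-1})` into a formula for `α_n` in terms of `b_n = z S_n'` and `S_n''`;
inserted in the first integral, this is the second-order equation for `S_n`. The `σ`-equation is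
the same equation after an affine change of the unknown (`solvesSEquation_iff_shift`).
-/

open Polynomial Finset

namespace GenCharlier

/-! ### Monic orthogonal polynomials of a positive linear functional -/

/-- The monic orthogonal polynomials of a linear functional `L`, defined through their three-term
recurrence; the coefficients are junk unless all `L (P_n * P_n)` are nonzero. -/
noncomputable def orthoPoly (L : ℝ[X] →ₗ[ℝ] ℝ) : ℕ → ℝ[X]
  | 0 => 1
  | 1 => X - C (L X / L 1)
  | n + 2 =>
    (X - C (L (X * (orthoPoly L (n + 1) * orthoPoly L (n + 1)))
        / L (orthoPoly L (n + 1) * orthoPoly L (n + 1)))) * orthoPoly L (n + 1)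
      - C (L (orthoPoly L (n + 1) * orthoPoly L (n + 1)) / L (orthoPoly L n * orthoPoly L n))
        * orthoPoly L n

/-- The squared norm `h_n = L (P_n²)`. -/
noncomputable def sqNorm (L : ℝ[X] →ₗ[ℝ] ℝ) (n : ℕ) : ℝ := L (orthoPoly L n * orthoPoly L n)

/-- The diagonal recurrence coefficient `α_n = L (x P_n²) / h_n`. -/
noncomputable def recA (L : ℝ[X] →ₗ[ℝ] ℝ) (n : ℕ) : ℝ :=
  L (X * (orthoPoly L n * orthoPoly L n)) / sqNorm L n

/-- The off-diagonal recurrence coefficient `b_n = h_n / h_{n-1}`, with `b_0 = 0`. -/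
noncomputable def recB (L : ℝ[X] →ₗ[ℝ] ℝ) : ℕ → ℝ
  | 0 => 0
  | n + 1 => sqNorm L (n + 1) / sqNorm L n

/-- A sequence of polynomials with `R_0 = 1` and `R_{n+1} = (x - a_n) R_n - b_n R_{n-1}`. -/
structure ThreeTerm (a b : ℕ → ℝ) (R : ℕ → ℝ[X]) : Prop where
  zero : R 0 = 1
  one : R 1 = X - C (a 0)
  step : ∀ n, R (n + 2) = (X - C (a (n + 1))) * R (n + 1) - C (b (n + 1)) * R n

/-- The second-subleading coefficient of the `n`-th polynomial of a three-term sequence. -/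
def subsubCoeff (a b : ℕ → ℝ) : ℕ → ℝ
  | 0 => 0
  | n + 1 => subsubCoeff a b n + a n * (∑ k ∈ range n, a k) - b n

namespace ThreeTerm

variable {a b : ℕ → ℝ} {R : ℕ → ℝ[X]}

lemma natDegree_le (h : ThreeTerm a b R) (n : ℕ) : (R n).natDegree ≤ n := by
  induction n using Nat.strong_induction_on with
  | _ n ih =>
    match n with
    | 0 => simp [h.zero]
    | 1 => rw [h.one]; exact natDegree_X_sub_C_le _
    | n + 2 =>
      rw [h.step]
      have h1 := ih (n + 1) (by omega)
      have h0 := ih n (by omega)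
      refine (natDegree_sub_le _ _).trans (max_le ?_ ?_)
      · refine natDegree_mul_le.trans ?_
        have := natDegree_X_sub_C_le (a (n + 1))
        omega
      · exact (natDegree_C_mul_le _ _).trans (by omega)

/-- The three leading coefficients. Multiplying by `X ^ 2` makes the formulas uniform in `n`:
a coefficient of negative index reads as zero. -/
lemma coeff_sq_mul (h : ThreeTerm a b R) (hb : b 0 = 0) (n : ℕ) :
    (X ^ 2 * R n).coeff (n + 2) = 1 ∧
    (X ^ 2 * R n).coeff (n + 1) = -∑ k ∈ range n, a k ∧
    (X ^ 2 * R n).coeff n = subsubCoeff a b n := by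
  induction n using Nat.strong_induction_on with
  | _ n ih =>
    match n with
    | 0 => simp [h.zero, subsubCoeff, coeff_X_pow]
    | 1 =>
      have e : X ^ 2 * R 1 = X ^ 3 - C (a 0) * X ^ 2 := by rw [h.one]; ring
      simp only [e]
      simp [subsubCoeff, coeff_X_pow, hb]
    | n + 2 =>
      obtain ⟨u2, u1, u0⟩ := ih (n + 1) (by omega)
      obtain ⟨v2, v1, v0⟩ := ih n (by omega)
      have hz : (X ^ 2 * R (n + 1)).coeff (n + 4) = 0 := by
        rw [coeff_X_pow_mul]; exact coeff_eq_zero_of_natDegree_lt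
          (by have := h.natDegree_le (n + 1); omega)
      have hz2 : (X ^ 2 * R n).coeff (n + 4) = 0 := by
        rw [coeff_X_pow_mul]; exact coeff_eq_zero_of_natDegree_lt
          (by have := h.natDegree_le n; omega)
      have hz3 : (X ^ 2 * R n).coeff (n + 3) = 0 := by
        rw [show n + 3 = n + 1 + 2 from rfl, coeff_X_pow_mul]
        exact coeff_eq_zero_of_natDegree_lt (by have := h.natDegree_le n; omega)
      have e : X ^ 2 * R (n + 2) = X * (X ^ 2 * R (n + 1)) - C (a (n + 1)) * (X ^ 2 * R (n + 1))
          - C (b (n + 1)) * (X ^ 2 * R n) := by rw [h.step]; ring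
      simp only [e, coeff_sub, coeff_C_mul, coeff_X_mul]
      refine ⟨?_, ?_, ?_⟩
      · rw [hz, hz2, u2]; ring
      · rw [hz3, u2, u1, sum_range_succ _ (n + 1)]; ring
      · rw [u1, u0, v2]; simp only [subsubCoeff]; ring

lemma coeff_self (h : ThreeTerm a b R) (hb : b 0 = 0) (n : ℕ) : (R n).coeff n = 1 := by
  have := (h.coeff_sq_mul hb n).1
  rwa [coeff_X_pow_mul] at this

lemma coeff_sub_one (h : ThreeTerm a b R) (hb : b 0 = 0) (n : ℕ) :
    (R (n + 1)).coeff n = -∑ k ∈ range (n + 1), a k := by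
  have := (h.coeff_sq_mul hb (n + 1)).2.1
  rwa [coeff_X_pow_mul] at this

lemma coeff_sub_two (h : ThreeTerm a b R) (hb : b 0 = 0) (n : ℕ) :
    (R (n + 2)).coeff n = subsubCoeff a b (n + 2) := by
  have := (h.coeff_sq_mul hb (n + 2)).2.2
  rwa [coeff_X_pow_mul] at this

/-- Translating the argument translates the diagonal recurrence coefficients. -/
lemma comp_add (h : ThreeTerm a b R) (c : ℝ) :
    ThreeTerm (fun n => a n - c) b fun n => (R n).comp (X + C c) where
  zero := by simp [h.zero]
  one := by simp only [h.one, sub_comp, X_comp, C_comp, C_sub]; ring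
  step n := by simp only [h.step, sub_comp, mul_comp, X_comp, C_comp, C_sub]; ring

end ThreeTerm

section

variable (L : ℝ[X] →ₗ[ℝ] ℝ)

lemma orthoPoly_threeTerm : ThreeTerm (recA L) (recB L) (orthoPoly L) where
  zero := by rw [orthoPoly]
  one := by simp [orthoPoly, recA, sqNorm]
  step n := by rw [orthoPoly]; rfl

lemma orthoPoly_natDegree_le (n : ℕ) : (orthoPoly L n).natDegree ≤ n :=
  (orthoPoly_threeTerm L).natDegree_le n

lemma orthoPoly_coeff_self (n : ℕ) : (orthoPoly L n).coeff n = 1 :=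
  (orthoPoly_threeTerm L).coeff_self rfl n

lemma orthoPoly_ne_zero (n : ℕ) : orthoPoly L n ≠ 0 := fun h => by
  simpa [h] using orthoPoly_coeff_self L n

variable {L}

lemma sqNorm_pos (hL : ∀ p : ℝ[X], p ≠ 0 → 0 < L (p * p)) (n : ℕ) : 0 < sqNorm L n :=
  hL _ (orthoPoly_ne_zero L n)

lemma map_C_mul (c : ℝ) (p : ℝ[X]) : L (C c * p) = c * L p := by
  rw [← smul_eq_C_mul, map_smul, smul_eq_mul]

/-- A degree bound together with a vanishing top coefficient lowers the bound. -/
lemma natDegree_le_of_coeff_eq_zero {p : ℝ[X]} {n : ℕ} (h : p.natDegree ≤ n + 1)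
    (h0 : p.coeff (n + 1) = 0) : p.natDegree ≤ n := by
  rw [natDegree_le_iff_coeff_eq_zero] at h ⊢
  intro N hN
  rcases (Nat.succ_le_of_lt hN).eq_or_lt with rfl | h'
  · exact h0
  · exact h N h'

lemma natDegree_sub_C_mul_orthoPoly {p : ℝ[X]} {n : ℕ} (h : p.natDegree ≤ n + 1) :
    (p - C (p.coeff (n + 1)) * orthoPoly L (n + 1)).natDegree ≤ n := by
  refine natDegree_le_of_coeff_eq_zero ?_ (by simp [orthoPoly_coeff_self])
  exact (natDegree_sub_le _ _).trans
    (max_le h ((natDegree_C_mul_le _ _).trans (orthoPoly_natDegree_le L _)))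

/-- Orthogonality: against a polynomial of degree at most `n`, the `n`-th orthogonal polynomial
only sees the coefficient of `X ^ n`. -/
theorem map_orthoPoly_mul (hL : ∀ p : ℝ[X], p ≠ 0 → 0 < L (p * p)) (n : ℕ) (p : ℝ[X])
    (hp : p.natDegree ≤ n) : L (orthoPoly L n * p) = p.coeff n * sqNorm L n := by
  induction n using Nat.strong_induction_on generalizing p with
  | _ n ih =>
  match n with
  | 0 =>
    rw [eq_C_of_natDegree_le_zero hp, mul_comm, map_C_mul]
    simp [sqNorm, orthoPoly]
  | 1 =>
    have h0 : L (orthoPoly L 1 * 1) = 0 := by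
      have := (sqNorm_pos hL 0).ne'
      simp only [sqNorm, orthoPoly, mul_one] at this ⊢
      rw [map_sub, ← mul_one (C _), map_C_mul]
      field_simp
      ring
    have hr := natDegree_sub_C_mul_orthoPoly (L := L) hp
    obtain ⟨d, hd⟩ : ∃ d, p = C d + C (p.coeff 1) * orthoPoly L 1 :=
      ⟨_, eq_add_of_sub_eq (eq_C_of_natDegree_le_zero hr)⟩
    have e : orthoPoly L 1 * p
        = C d * (orthoPoly L 1 * 1) + C (p.coeff 1) * (orthoPoly L 1 * orthoPoly L 1) := by
      conv_lhs => rw [hd]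
      ring
    rw [e, map_add, map_C_mul, map_C_mul, h0, sqNorm]; ring
  | n + 2 =>
    have k1 := fun q hq => ih (n + 1) (by omega) q hq
    have k0 := fun q hq => ih n (by omega) q hq
    have hs := (orthoPoly_threeTerm L).step n
    have hstep : ∀ q, L (orthoPoly L (n + 2) * q) = L (orthoPoly L (n + 1) * (X * q))
        - recA L (n + 1) * L (orthoPoly L (n + 1) * q) - recB L (n + 1) * L (orthoPoly L n * q) := by
      intro q
      rw [← map_C_mul, ← map_C_mul, ← map_sub, ← map_sub, hs]; congr 1; ring
    have hn1 := (sqNorm_pos hL (n + 1)).ne'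
    have hn0 := (sqNorm_pos hL n).ne'
    have z1 : L (orthoPoly L (n + 2) * orthoPoly L (n + 1)) = 0 := by
      rw [hstep, show orthoPoly L (n + 1) * (X * orthoPoly L (n + 1))
        = X * (orthoPoly L (n + 1) * orthoPoly L (n + 1)) by ring,
        mul_comm (orthoPoly L n), k1 _ ((orthoPoly_natDegree_le L n).trans (by omega)),
        coeff_eq_zero_of_natDegree_lt (Nat.lt_succ_of_le (orthoPoly_natDegree_le L n)), recA]
      change _ - _ / sqNorm L (n + 1) * sqNorm L (n + 1) - _ = 0
      field_simp
      ring
    have z0 : L (orthoPoly L (n + 2) * orthoPoly L n) = 0 := by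
      rw [hstep, k1 (X * orthoPoly L n), k1 (orthoPoly L n), coeff_X_mul, orthoPoly_coeff_self,
        coeff_eq_zero_of_natDegree_lt (Nat.lt_succ_of_le (orthoPoly_natDegree_le L n)), recB]
      · change _ - _ - _ / sqNorm L n * sqNorm L n = 0
        field_simp
        ring
      · exact (orthoPoly_natDegree_le L n).trans (by omega)
      · refine natDegree_mul_le.trans ?_
        have := orthoPoly_natDegree_le L n
        rw [natDegree_X]; omega
    have low : ∀ q : ℝ[X], q.natDegree ≤ n → q.coeff n = 0 → L (orthoPoly L (n + 2) * q) = 0 := by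
      intro q hq h0
      rw [hstep, k0 q hq, k1 q (by omega), k1 (X * q), coeff_X_mul, h0,
        coeff_eq_zero_of_natDegree_lt (Nat.lt_succ_of_le hq)]
      · ring
      · refine natDegree_mul_le.trans ?_
        rw [natDegree_X]; omega
    have d2 := natDegree_sub_C_mul_orthoPoly (L := L) hp
    set c := p.coeff (n + 2)
    set q := p - C c * orthoPoly L (n + 1 + 1) with hq
    have d1 := natDegree_sub_C_mul_orthoPoly (L := L) d2
    set d := q.coeff (n + 1)
    set r := q - C d * orthoPoly L (n + 1) with hr
    have l0 := low (r - C (r.coeff n) * orthoPoly L n)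
      ((natDegree_sub_le _ _).trans (max_le d1 ((natDegree_C_mul_le _ _).trans
        (orthoPoly_natDegree_le L _)))) (by simp [orthoPoly_coeff_self])
    have e : orthoPoly L (n + 2) * p
        = C c * (orthoPoly L (n + 2) * orthoPoly L (n + 2))
          + C d * (orthoPoly L (n + 2) * orthoPoly L (n + 1))
          + C (r.coeff n) * (orthoPoly L (n + 2) * orthoPoly L n)
          + orthoPoly L (n + 2) * (r - C (r.coeff n) * orthoPoly L n) := by
      rw [hr, hq]; ring
    rw [e, map_add, map_add, map_add, map_C_mul, map_C_mul, map_C_mul, z1, z0, l0, sqNorm]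
    ring

/-! ### Laguerre–Freud equations from the Pearson relation -/

/-- The Pearson relation of the weight `z^k / ((β+1)_k k!)`, in terms of its functional. -/
def Pearson (L : ℝ[X] →ₗ[ℝ] ℝ) (β z : ℝ) : Prop :=
  ∀ p : ℝ[X], L (X * (X + C β) * p) = z * L (p.comp (X + C 1))

variable {β z : ℝ}

lemma map_orthoPoly_mul_shift (hL : ∀ p : ℝ[X], p ≠ 0 → 0 < L (p * p)) (n : ℕ) :
    L (orthoPoly L n * (orthoPoly L n).comp (X + C 1)) = sqNorm L n := by
  have T := (orthoPoly_threeTerm L).comp_add 1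
  rw [map_orthoPoly_mul hL _ _ (T.natDegree_le n), T.coeff_self rfl, one_mul]

lemma map_orthoPoly_mul_shift_succ (hL : ∀ p : ℝ[X], p ≠ 0 → 0 < L (p * p)) (n : ℕ) :
    L (orthoPoly L n * (orthoPoly L (n + 1)).comp (X + C 1)) = (n + 1) * sqNorm L n := by
  have T0 := orthoPoly_threeTerm L
  have T := T0.comp_add 1
  have h0 : L (orthoPoly L n * orthoPoly L (n + 1)) = 0 := by
    rw [mul_comm, map_orthoPoly_mul hL _ _ ((T0.natDegree_le n).trans (by omega)),
      coeff_eq_zero_of_natDegree_lt (Nat.lt_succ_of_le (T0.natDegree_le n)), zero_mul]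
  have h1 := map_orthoPoly_mul hL n ((orthoPoly L (n + 1)).comp (X + C 1) - orthoPoly L (n + 1))
    (natDegree_le_of_coeff_eq_zero ((natDegree_sub_le _ _).trans
      (max_le (T.natDegree_le _) (T0.natDegree_le _)))
      (by rw [coeff_sub, T.coeff_self rfl, T0.coeff_self rfl, sub_self]))
  rw [mul_sub, map_sub, h0, sub_zero, coeff_sub, T.coeff_sub_one rfl, T0.coeff_sub_one rfl] at h1
  rw [h1, sum_sub_distrib]
  simp

lemma subsubCoeff_add_one (a b : ℕ → ℝ) (n : ℕ) :
    subsubCoeff (fun k => a k - -1) b n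
      = subsubCoeff a b n + (n - 1) * (∑ k ∈ range n, a k) + n * (n - 1) / 2 := by
  induction n with
  | zero => simp [subsubCoeff]
  | succ n ih =>
    simp only [subsubCoeff, ih, sum_range_succ, sum_sub_distrib]
    simp
    ring

/-- Coefficients of the left-hand side of the structure relation
`x (x + β) P_n (x - 1) = P_{n+2} + A P_{n+1} + z P_n`. -/
lemma structure_coeffs (L : ℝ[X] →ₗ[ℝ] ℝ) (β : ℝ) (n : ℕ) :
    let F := X * (X + C β) * (orthoPoly L n).comp (X + C (-1))
    F.natDegree ≤ n + 2 ∧ F.coeff (n + 2) = 1 ∧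
      F.coeff (n + 1) = β - n - ∑ k ∈ range n, recA L k ∧
      F.coeff n = subsubCoeff (fun k => recA L k - -1) (recB L) n
        - β * ((∑ k ∈ range n, recA L k) + n) := by
  intro F
  have T := (orthoPoly_threeTerm L).comp_add (-1)
  obtain ⟨t2, t1, t0⟩ := T.coeff_sq_mul rfl n
  have e : F = X ^ 2 * (orthoPoly L n).comp (X + C (-1))
      + C β * (X * (orthoPoly L n).comp (X + C (-1))) := by simp only [F]; ring
  have s : ∀ m, (X * (orthoPoly L n).comp (X + C (-1))).coeff m
      = (X ^ 2 * (orthoPoly L n).comp (X + C (-1))).coeff (m + 1) := by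
    intro m
    rw [show X ^ 2 * (orthoPoly L n).comp (X + C (-1))
      = X * (X * (orthoPoly L n).comp (X + C (-1))) by ring, coeff_X_mul]
  have hd := T.natDegree_le n
  refine ⟨?_, ?_, ?_, ?_⟩
  · simp only [F]
    refine natDegree_mul_le.trans ?_
    have : (X * (X + C β) : ℝ[X]).natDegree ≤ 2 := by
      refine natDegree_mul_le.trans ?_
      rw [natDegree_X, natDegree_X_add_C]
    omega
  · rw [e, coeff_add, coeff_C_mul, t2, coeff_X_mul, coeff_eq_zero_of_natDegree_lt (by omega)]
    ring
  · rw [e, coeff_add, coeff_C_mul, s, t2, t1, sum_sub_distrib]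
    simp
    ring
  · rw [e, coeff_add, coeff_C_mul, s, t1, t0, sum_sub_distrib]
    simp
    ring

/-- The left-hand side of the structure relation paired with any polynomial. -/
lemma Pearson.map_structure (hP : Pearson L β z) (p q : ℝ[X]) :
    L (X * (X + C β) * p.comp (X + C (-1)) * q) = z * L (p * q.comp (X + C 1)) := by
  rw [mul_assoc, hP, mul_comp, comp_assoc]
  simp

/-- Pairing the structure relation with `P_{n+1}`. -/
theorem laguerreFreud_one (hL : ∀ p : ℝ[X], p ≠ 0 → 0 < L (p * p)) (hP : Pearson L β z) (n : ℕ) :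
    recB L (n + 1) * (recA L n + recA L (n + 1) + β - n) = z * (n + 1) := by
  have T := orthoPoly_threeTerm L
  obtain ⟨fd, f2, f1, -⟩ := structure_coeffs L β n
  have hs := hP.map_structure (orthoPoly L n) (orthoPoly L (n + 1))
  rw [map_orthoPoly_mul_shift_succ hL] at hs
  set F := X * (X + C β) * (orthoPoly L n).comp (X + C (-1))
  have hd := natDegree_sub_C_mul_orthoPoly (L := L) fd
  have h1 := map_orthoPoly_mul hL (n + 1) _ hd
  have h0 : L (orthoPoly L (n + 2) * orthoPoly L (n + 1)) = 0 := by
    rw [map_orthoPoly_mul hL _ _ ((T.natDegree_le _).trans (by omega)),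
      coeff_eq_zero_of_natDegree_lt (Nat.lt_succ_of_le (T.natDegree_le _)), zero_mul]
  rw [f2, C_1, one_mul, mul_sub, map_sub, mul_comm _ F, hs, mul_comm (orthoPoly L (n + 1)), h0,
    coeff_sub, f1, T.coeff_sub_one rfl, sum_range_succ, sum_range_succ] at h1
  have hn := (sqNorm_pos hL n).ne'
  rw [recB]
  field_simp
  linarith

/-- Pairing the structure relation with `P_n`. -/
theorem laguerreFreud_two (hL : ∀ p : ℝ[X], p ≠ 0 → 0 < L (p * p)) (hP : Pearson L β z) (n : ℕ) :
    recB L n + recB L (n + 1) - z - (∑ k ∈ range n, recA L k) + n * (n - 1) / 2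
      + (recA L n - n) * (recA L n + β) = 0 := by
  have T := orthoPoly_threeTerm L
  obtain ⟨fd, f2, f1, f0⟩ := structure_coeffs L β n
  have hs := hP.map_structure (orthoPoly L n) (orthoPoly L n)
  rw [map_orthoPoly_mul_shift hL] at hs
  set F := X * (X + C β) * (orthoPoly L n).comp (X + C (-1))
  have hd := natDegree_sub_C_mul_orthoPoly (L := L) fd
  rw [f2, C_1, one_mul] at hd
  have hd' := natDegree_sub_C_mul_orthoPoly (L := L) hd
  have h1 := map_orthoPoly_mul hL n _ hd'
  have h0 : ∀ m, L (orthoPoly L n * orthoPoly L (n + 1 + m)) = 0 := by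
    intro m
    rw [mul_comm, map_orthoPoly_mul hL _ _ ((T.natDegree_le _).trans (by omega)),
      coeff_eq_zero_of_natDegree_lt (Nat.lt_of_le_of_lt (T.natDegree_le _) (by omega)), zero_mul]
  have h00 := h0 0
  have h01 := h0 1
  rw [add_zero] at h00
  rw [mul_sub, mul_sub, map_sub, map_sub, mul_comm _ F, hs, h01, mul_left_comm, map_C_mul, h00]
    at h1
  simp only [coeff_sub, coeff_C_mul, f0, f1] at h1
  rw [T.coeff_sub_one rfl, T.coeff_sub_one rfl,
    T.coeff_sub_two rfl, subsubCoeff_add_one, subsubCoeff, subsubCoeff, sum_range_succ,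
    sum_range_succ] at h1
  have hn := (sqNorm_pos hL n).ne'
  simp only [sub_zero, mul_zero] at h1
  linarith [mul_right_cancel₀ hn h1]

/-- The nonlinear Laguerre–Freud equation: by the other two, the difference of its sides does not
depend on `n`. -/
theorem laguerreFreud_three (hL : ∀ p : ℝ[X], p ≠ 0 → 0 < L (p * p)) (hP : Pearson L β z) (n : ℕ) :
    (recB L (n + 1) - z) * (recB L n - z) = z * (recA L n - n) * (recA L n + β - n) := by
  induction n with
  | zero =>
    have := laguerreFreud_two hL hP 0
    simp [recB] at this ⊢
    linear_combination -z * this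
  | succ n ih =>
    have e1 := laguerreFreud_one hL hP n
    have e2 := laguerreFreud_two hL hP n
    have e3 := laguerreFreud_two hL hP (n + 1)
    rw [sum_range_succ] at e3
    push_cast at e3 ⊢
    linear_combination ih + (recB L (n + 1) - z) * (e3 - e2)
      + (recA L n + 1 - recA L (n + 1)) * e1

/-- The first integral that expresses `S_n = ∑_{k<n} α_k` through `α_n` and `b_n`. -/
theorem first_integral (hL : ∀ p : ℝ[X], p ≠ 0 → 0 < L (p * p)) (hP : Pearson L β z) (n : ℕ) :
    -(recB L n - z) * (recB L n - (∑ k ∈ range n, recA L k) + n * (n - 1) / 2)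
      = (recA L n - n) * (recB L n * (recA L n + β) - z * n) := by
  linear_combination laguerreFreud_three hL hP n
    - (recB L n - z) * laguerreFreud_two hL hP n

end

/-! ### Moments of the generalized Charlier weight -/

lemma ascPochhammer_eval_pos {β : ℝ} (hβ : -1 < β) (k : ℕ) :
    0 < (ascPochhammer ℝ k).eval (β + 1) :=
  ascPochhammer_pos k _ (by linarith)

lemma weight_pos {β z : ℝ} (hβ : -1 < β) (hz : 0 < z) (k : ℕ) : 0 < weight β z k :=
  div_pos (pow_pos hz k) (mul_pos (ascPochhammer_eval_pos hβ k) (by positivity))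

/-- The Pearson recursion of the weight. -/
lemma weight_succ {β : ℝ} (hβ : -1 < β) (z : ℝ) (k : ℕ) :
    ((k : ℝ) + 1) * ((k : ℝ) + 1 + β) * weight β z (k + 1) = z * weight β z k := by
  have h := (ascPochhammer_eval_pos hβ k).ne'
  have h2 : β + 1 + k ≠ 0 := by have := k.cast_nonneg (α := ℝ); linarith
  rw [weight, weight, ascPochhammer_succ_eval, Nat.factorial_succ]
  push_cast
  have h3 : (k.factorial : ℝ) ≠ 0 := by positivity
  have h4 : (k : ℝ) + 1 ≠ 0 := by positivity
  field_simp
  ring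

lemma ascPochhammer_eval_ge {β : ℝ} (hβ : -1 < β) (k : ℕ) :
    min 1 (β + 1) ≤ (ascPochhammer ℝ k).eval (β + 1) := by
  rcases k with _ | k
  · simp
  · refine (min_le_right _ _).trans ?_
    rw [ascPochhammer_succ_left, eval_mul, eval_X, eval_comp]
    have h : (1 : ℝ) ≤ (ascPochhammer ℝ k).eval (β + 1 + 1) := by
      induction k with
      | zero => simp
      | succ k ih =>
        rw [ascPochhammer_succ_eval]
        have := k.cast_nonneg (α := ℝ)
        nlinarith
    simp only [eval_add, eval_X, eval_one]
    nlinarith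

/-- Convergence of all moments, for arguments of either sign. -/
lemma summable_pow_mul_weight {β : ℝ} (hβ : -1 < β) (z : ℝ) (m : ℕ) :
    Summable fun k : ℕ => (k : ℝ) ^ m * weight β z k := by
  set c := min 1 (β + 1)
  have hc : 0 < c := lt_min one_pos (by linarith)
  refine Summable.of_norm_bounded (g := fun k : ℕ =>
    (m.factorial / c) * ((Real.exp 1 * |z|) ^ k / k.factorial))
    ((Real.summable_pow_div_factorial _).mul_left _) fun k => ?_
  have h1 : (k : ℝ) ^ m ≤ m.factorial * Real.exp 1 ^ k := by
    have := Real.pow_div_factorial_le_exp (k : ℝ) (by positivity) m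
    rw [div_le_iff₀ (by positivity)] at this
    rw [← Real.exp_nat_mul, mul_one]
    linarith
  have hp := ascPochhammer_eval_pos hβ k
  rw [weight, norm_mul, norm_div, norm_pow, norm_pow, norm_mul, Real.norm_eq_abs, Real.norm_eq_abs,
    Real.norm_eq_abs, Real.norm_eq_abs, Nat.abs_cast, abs_of_pos hp, Nat.abs_cast, mul_pow]
  calc (k : ℝ) ^ m * (|z| ^ k / ((ascPochhammer ℝ k).eval (β + 1) * k.factorial))
      ≤ (m.factorial * Real.exp 1 ^ k) * (|z| ^ k / (c * k.factorial)) := by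
        gcongr
        exact ascPochhammer_eval_ge hβ k
    _ = _ := by field_simp

lemma hasDerivAt_weight (β z : ℝ) (k : ℕ) :
    HasDerivAt (fun w => weight β w k) (k * z ^ (k - 1) /
      ((ascPochhammer ℝ k).eval (β + 1) * (k.factorial : ℝ))) z :=
  (hasDerivAt_pow k z).div_const _

lemma mul_deriv_weight (β z : ℝ) (k : ℕ) :
    z * (k * z ^ (k - 1) / ((ascPochhammer ℝ k).eval (β + 1) * (k.factorial : ℝ)))
      = k * weight β z k := by
  rcases k with _ | k
  · simp
  · rw [weight, Nat.add_sub_cancel, pow_succ]; ring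

/-- The Euler operator raises the order of the moments. -/
lemma hasDerivAt_moment {β z : ℝ} (hβ : -1 < β) (hz : 0 < z) (m : ℕ) :
    HasDerivAt (fun w => moment β w m) (moment β z (m + 1) / z) z := by
  set r := z + 1
  have hr : 0 < r := by positivity
  have key := hasDerivAt_tsum_of_isPreconnected
    (g := fun (k : ℕ) w => (k : ℝ) ^ m * weight β w k)
    (g' := fun (k : ℕ) w => (k : ℝ) ^ m *
      (k * w ^ (k - 1) / ((ascPochhammer ℝ k).eval (β + 1) * (k.factorial : ℝ))))
    (u := fun k : ℕ => r⁻¹ * ((k : ℝ) ^ (m + 1) * weight β r k))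
    (t := Set.Ioo 0 r) (y₀ := z) (y := z)
    ((summable_pow_mul_weight hβ r (m + 1)).mul_left _) isOpen_Ioo isPreconnected_Ioo
    (fun k w _ => (hasDerivAt_weight β w k).const_mul _) ?_ ⟨hz, by simp [r]⟩
    (summable_pow_mul_weight hβ z m) ⟨hz, by simp [r]⟩
  · refine key.congr_deriv ?_
    rw [moment, ← tsum_div_const]
    refine tsum_congr fun k => ?_
    rw [eq_div_iff hz.ne', pow_succ, mul_assoc _ (k : ℝ), ← mul_deriv_weight]
    ring
  · intro k w hw
    have hp := ascPochhammer_eval_pos hβ k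
    have hw0 := hw.1
    rw [Real.norm_of_nonneg (by positivity)]
    calc _ ≤ (k : ℝ) ^ m *
          (k * r ^ (k - 1) / ((ascPochhammer ℝ k).eval (β + 1) * (k.factorial : ℝ))) := by
          gcongr
          exact hw.2.le
      _ = _ := by
          rw [pow_succ, mul_assoc ((k : ℝ) ^ m), ← mul_deriv_weight]
          field_simp

lemma Gamma_add_nat {β : ℝ} (hβ : -1 < β) (k : ℕ) :
    Real.Gamma (β + k + 1) = (ascPochhammer ℝ k).eval (β + 1) * Real.Gamma (β + 1) := by
  induction k with
  | zero => simp
  | succ k ih =>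
    have h : β + k + 1 ≠ 0 := by have := k.cast_nonneg (α := ℝ); linarith
    push_cast
    rw [ascPochhammer_succ_eval, show β + (k + 1) + 1 = (β + k + 1) + 1 by ring,
      Real.Gamma_add_one h, ih]
    ring

/-- The generating Bessel function is the zeroth moment up to the Gamma factor. -/
lemma Gamma_mul_besselI {β z : ℝ} (hβ : -1 < β) (hz : 0 < z) :
    z ^ (-β / 2) * besselI β (2 * Real.sqrt z) = moment β z 0 / Real.Gamma (β + 1) := by
  rw [besselI, moment, ← tsum_mul_left, ← tsum_div_const]
  refine tsum_congr fun k => ?_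
  have e : (2 * Real.sqrt z / 2) ^ (2 * (k : ℝ) + β) = z ^ k * z ^ (β / 2) := by
    rw [mul_div_cancel_left₀ _ two_ne_zero, Real.sqrt_eq_rpow, ← Real.rpow_mul hz.le,
      ← Real.rpow_natCast, ← Real.rpow_add hz]
    congr 1; ring
  have hg := (Real.Gamma_pos_of_pos (show 0 < β + 1 by linarith)).ne'
  have hp := (ascPochhammer_eval_pos hβ k).ne'
  have hq := (Real.rpow_pos_of_pos hz (β / 2)).ne'
  rw [e, Gamma_add_nat hβ, neg_div, Real.rpow_neg hz.le, weight]
  field_simp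

lemma iterate_euler_besselI {β : ℝ} (hβ : -1 < β) (m : ℕ) :
    ∀ z : ℝ, 0 < z → (euler^[m] fun w => w ^ (-β / 2) * besselI β (2 * Real.sqrt w)) z
      = moment β z m / Real.Gamma (β + 1) := by
  induction m with
  | zero => exact fun z hz => Gamma_mul_besselI hβ hz
  | succ m ih =>
    intro z hz
    rw [Function.iterate_succ_apply', euler]
    have h := ((hasDerivAt_moment hβ hz m).div_const (Real.Gamma (β + 1))).congr_of_eventuallyEq
      (Filter.eventually_of_mem (Ioi_mem_nhds hz) fun w hw => ih w hw)
    rw [h.deriv]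
    field_simp

lemma Delta_eq_det {β z : ℝ} (hβ : -1 < β) (hz : 0 < z) (n : ℕ) :
    Delta n β z = (Matrix.of fun i j : Fin n => moment β z ((i : ℕ) + (j : ℕ))).det := by
  have hg := (Real.Gamma_pos_of_pos (show 0 < β + 1 by linarith)).ne'
  have e : (Matrix.of fun i j : Fin n => moment β z ((i : ℕ) + (j : ℕ)))
      = Real.Gamma (β + 1) • Matrix.of fun i j : Fin n =>
        (euler^[(i : ℕ) + (j : ℕ)] fun w => w ^ (-β / 2) * besselI β (2 * Real.sqrt w)) z := by
    ext i j
    simp only [Matrix.of_apply, Matrix.smul_apply, iterate_euler_besselI hβ _ z hz, smul_eq_mul]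
    field_simp
  rw [e, Matrix.det_smul, Fintype.card_fin]
  rfl

/-! ### The moment functional -/

/-- The linear functional `X ^ m ↦ μ_m` on polynomials. -/
noncomputable def momentFunctional (β z : ℝ) : ℝ[X] →ₗ[ℝ] ℝ :=
  Polynomial.lsum fun m => moment β z m • LinearMap.id

lemma momentFunctional_eq_sum (β z : ℝ) {p : ℝ[X]} {N : ℕ} (h : p.natDegree ≤ N) :
    momentFunctional β z p = ∑ m ∈ range (N + 1), p.coeff m * moment β z m := by
  rw [momentFunctional, Polynomial.lsum_apply, sum_over_range' _ (by simp) (N + 1) (by omega)]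
  simp [mul_comm]

lemma hasSum_momentFunctional {β : ℝ} (hβ : -1 < β) (z : ℝ) (p : ℝ[X]) :
    HasSum (fun k : ℕ => p.eval (k : ℝ) * weight β z k) (momentFunctional β z p) := by
  rw [momentFunctional_eq_sum β z le_rfl]
  have h := hasSum_sum (s := range (p.natDegree + 1)) fun m _ =>
    ((summable_pow_mul_weight hβ z m).hasSum).mul_left (p.coeff m)
  refine h.congr_fun fun k => ?_
  rw [eval_eq_sum_range, sum_mul]
  exact sum_congr rfl fun m _ => mul_assoc _ _ _

lemma momentFunctional_mul_self_pos {β z : ℝ} (hβ : -1 < β) (hz : 0 < z) (p : ℝ[X]) (hp : p ≠ 0) :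
    0 < momentFunctional β z (p * p) := by
  have h := hasSum_momentFunctional hβ z (p * p)
  obtain ⟨k, hk⟩ : ∃ k : ℕ, p.eval (k : ℝ) ≠ 0 := by
    by_contra! hc
    refine hp (Polynomial.eq_zero_of_infinite_isRoot p
      ((Set.infinite_range_of_injective (Nat.cast_injective (R := ℝ))).mono ?_))
    rintro _ ⟨k, rfl⟩
    exact hc k
  rw [← h.tsum_eq]
  refine h.summable.tsum_pos (fun i => ?_) k ?_
  · rw [eval_mul]
    exact mul_nonneg (mul_self_nonneg _) (weight_pos hβ hz i).le
  · rw [eval_mul]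
    exact mul_pos (mul_self_pos.mpr hk) (weight_pos hβ hz k)

lemma pearson_momentFunctional {β : ℝ} (hβ : -1 < β) (z : ℝ) :
    Pearson (momentFunctional β z) β z := by
  intro p
  have h1 := hasSum_momentFunctional hβ z (X * (X + C β) * p)
  have h2 := (hasSum_momentFunctional hβ z (p.comp (X + C 1))).mul_left z
  rw [← hasSum_nat_add_iff' 1] at h1
  simp only [sum_range_one, Nat.cast_zero, eval_mul, eval_X, zero_mul, sub_zero] at h1
  refine h1.unique (h2.congr_fun fun k => ?_)
  have hw := weight_succ hβ z k
  simp only [eval_X, eval_add, eval_C, eval_comp]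
  push_cast
  linear_combination p.eval ((k : ℝ) + 1) * hw

/-! ### The Hankel determinant as a product of norms -/

theorem det_hankel_eq_prod {L : ℝ[X] →ₗ[ℝ] ℝ} (hL : ∀ p : ℝ[X], p ≠ 0 → 0 < L (p * p)) (n : ℕ) :
    (Matrix.of fun i j : Fin n => L (X ^ ((i : ℕ) + (j : ℕ)))).det
      = ∏ k ∈ range n, sqNorm L k := by
  set M : Matrix (Fin n) (Fin n) ℝ := Matrix.of fun i j => L (X ^ ((i : ℕ) + (j : ℕ)))
  set B : Matrix (Fin n) (Fin n) ℝ := Matrix.of fun i j => (orthoPoly L j).coeff i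
  have hdeg : ∀ k, (orthoPoly L k).natDegree = k := fun k =>
    natDegree_eq_of_le_of_coeff_ne_zero (orthoPoly_natDegree_le L k)
      (by rw [orthoPoly_coeff_self]; exact one_ne_zero)
  have hB : B.det = 1 := Matrix.det_matrixOfPolynomials _ (fun i => hdeg i) fun i => by
    rw [Monic, leadingCoeff, hdeg, orthoPoly_coeff_self]
  have hexp : ∀ j : Fin n, orthoPoly L j = ∑ i : Fin n, C (B i j) * X ^ (i : ℕ) := by
    intro j
    exact (as_sum_range_C_mul_X_pow' _ (by rw [hdeg]; exact j.2)).trans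
      (Fin.sum_univ_eq_sum_range (fun i => C ((orthoPoly L j).coeff i) * X ^ i) n).symm
  have hG : B.transpose * M * B = Matrix.diagonal fun i : Fin n => sqNorm L i := by
    ext i j
    have e : (B.transpose * M * B) i j = L (orthoPoly L i * orthoPoly L j) := by
      rw [hexp i, hexp j, sum_mul_sum, map_sum, Matrix.mul_apply]
      simp only [map_sum, Matrix.mul_apply, Finset.sum_mul]
      rw [sum_comm]
      refine sum_congr rfl fun k _ => sum_congr rfl fun l _ => ?_
      rw [show C (B k i) * X ^ (k : ℕ) * (C (B l j) * X ^ (l : ℕ))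
        = C (B k i) * (C (B l j) * X ^ ((k : ℕ) + l)) by ring, map_C_mul, map_C_mul]
      simp only [Matrix.transpose_apply, M, Matrix.of_apply]
      ring
    rw [e]
    rcases lt_trichotomy i j with h | h | h
    · rw [Matrix.diagonal_apply_ne _ h.ne, mul_comm, map_orthoPoly_mul hL _ _
        ((hdeg i).le.trans h.le), coeff_eq_zero_of_natDegree_lt (by rw [hdeg]; exact h), zero_mul]
    · rw [h, Matrix.diagonal_apply_eq, sqNorm]
    · rw [Matrix.diagonal_apply_ne _ h.ne', map_orthoPoly_mul hL _ _
        ((hdeg j).le.trans h.le), coeff_eq_zero_of_natDegree_lt (by rw [hdeg]; exact h), zero_mul]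
  have := congrArg Matrix.det hG
  rw [Matrix.det_mul, Matrix.det_mul, Matrix.det_transpose, hB, Matrix.det_diagonal, one_mul,
    mul_one] at this
  rw [this, Fin.prod_univ_eq_prod_range (fun k => sqNorm L k)]

/-! ### Toda equations in the variable `z` -/

/-- The family of polynomials `F w` is differentiable at `z`, coefficient by coefficient, with
derivative `F'`. -/
def HasCoeffDerivAt (F : ℝ → ℝ[X]) (F' : ℝ[X]) (z : ℝ) : Prop :=
  ∀ j, HasDerivAt (fun w => (F w).coeff j) (F'.coeff j) z

namespace HasCoeffDerivAt

variable {F G : ℝ → ℝ[X]} {F' G' : ℝ[X]} {z : ℝ}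

lemma const (p : ℝ[X]) : HasCoeffDerivAt (fun _ => p) 0 z := fun j => by
  simpa using hasDerivAt_const z (p.coeff j)

lemma of_C {f : ℝ → ℝ} {f' : ℝ} (h : HasDerivAt f f' z) :
    HasCoeffDerivAt (fun w => C (f w)) (C f') z := fun j => by
  rcases j with _ | j
  · simpa using h
  · simpa [coeff_C] using hasDerivAt_const z (0 : ℝ)

lemma sub (hF : HasCoeffDerivAt F F' z) (hG : HasCoeffDerivAt G G' z) :
    HasCoeffDerivAt (fun w => F w - G w) (F' - G') z := fun j => by
  simpa using (hF j).fun_sub (hG j)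

lemma mul (hF : HasCoeffDerivAt F F' z) (hG : HasCoeffDerivAt G G' z) :
    HasCoeffDerivAt (fun w => F w * G w) (F' * G z + F z * G') z := fun j => by
  simp only [coeff_mul, coeff_add, ← sum_add_distrib]
  exact HasDerivAt.fun_sum fun x _ => (hF x.1).mul (hG x.2)

lemma natDegree_le (hF : HasCoeffDerivAt F F' z) {N : ℕ} (h : ∀ w, (F w).natDegree ≤ N) :
    F'.natDegree ≤ N := by
  rw [natDegree_le_iff_coeff_eq_zero]
  intro j hj
  have h1 := hF j
  simp only [fun w => coeff_eq_zero_of_natDegree_lt ((h w).trans_lt hj)] at h1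
  exact h1.unique (hasDerivAt_const z 0)

/-- Leibniz rule for the moment functional of a `z`-dependent polynomial. -/
lemma momentFunctional {β : ℝ} (hβ : -1 < β) (hz : 0 < z) (hF : HasCoeffDerivAt F F' z) {N : ℕ}
    (h : ∀ w, (F w).natDegree ≤ N) :
    HasDerivAt (fun w => GenCharlier.momentFunctional β w (F w))
      (GenCharlier.momentFunctional β z F' + GenCharlier.momentFunctional β z (X * F z) / z) z := by
  have hX : (X * F z).natDegree ≤ N + 1 := natDegree_mul_le.trans (by
    rw [natDegree_X]; have := h z; omega)
  rw [momentFunctional_eq_sum β z (hF.natDegree_le h), momentFunctional_eq_sum β z hX,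
    sum_range_succ' _ (N + 1)]
  simp only [fun w => momentFunctional_eq_sum β w (h w), coeff_X_mul, mul_coeff_zero,
    coeff_X_zero, zero_mul, add_zero]
  rw [sum_div, ← sum_add_distrib]
  refine (HasDerivAt.fun_sum fun j _ => (hF j).mul (hasDerivAt_moment hβ hz j)).congr_deriv ?_
  exact sum_congr rfl fun j _ => by ring

end HasCoeffDerivAt

variable {β z : ℝ}

/-- `P_n` as a polynomial family in `z`. -/
noncomputable abbrev charlierPoly (β : ℝ) (n : ℕ) (z : ℝ) : ℝ[X] :=
  orthoPoly (momentFunctional β z) n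

lemma hasDerivAt_sqNorm_of (hβ : -1 < β) (hz : 0 < z) {n : ℕ} {D : ℝ[X]}
    (h : HasCoeffDerivAt (charlierPoly β n) D z) :
    HasDerivAt (fun w => sqNorm (momentFunctional β w) n)
      (momentFunctional β z (D * charlierPoly β n z + charlierPoly β n z * D)
        + momentFunctional β z (X * (charlierPoly β n z * charlierPoly β n z)) / z) z :=
  (h.mul h).momentFunctional hβ hz (N := n + n) fun _ => natDegree_mul_le.trans
    (add_le_add (orthoPoly_natDegree_le _ _) (orthoPoly_natDegree_le _ _))

lemma differentiableAt_recA_of (hβ : -1 < β) (hz : 0 < z) {n : ℕ} {D : ℝ[X]}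
    (h : HasCoeffDerivAt (charlierPoly β n) D z) :
    DifferentiableAt ℝ (fun w => recA (momentFunctional β w) n) z := by
  have h1 := ((HasCoeffDerivAt.const (z := z) X).mul (h.mul h)).momentFunctional hβ hz
    (N := 1 + (n + n)) fun _ => natDegree_mul_le.trans
    (add_le_add natDegree_X_le (natDegree_mul_le.trans
    (add_le_add (orthoPoly_natDegree_le _ _) (orthoPoly_natDegree_le _ _))))
  exact h1.differentiableAt.div (hasDerivAt_sqNorm_of hβ hz h).differentiableAt
    (sqNorm_pos (momentFunctional_mul_self_pos hβ hz) n).ne'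

lemma differentiableAt_recB_of (hβ : -1 < β) (hz : 0 < z) {n : ℕ} {D D' : ℝ[X]}
    (h : HasCoeffDerivAt (charlierPoly β n) D z)
    (h' : HasCoeffDerivAt (charlierPoly β (n + 1)) D' z) :
    DifferentiableAt ℝ (fun w => recB (momentFunctional β w) (n + 1)) z :=
  (hasDerivAt_sqNorm_of hβ hz h').differentiableAt.div (hasDerivAt_sqNorm_of hβ hz h).differentiableAt
    (sqNorm_pos (momentFunctional_mul_self_pos hβ hz) n).ne'

theorem exists_hasCoeffDerivAt_charlierPoly (hβ : -1 < β) (hz : 0 < z) (n : ℕ) :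
    ∃ D, HasCoeffDerivAt (charlierPoly β n) D z := by
  induction n using Nat.strong_induction_on with
  | _ n ih =>
  match n with
  | 0 =>
    have e : charlierPoly β 0 = fun _ => 1 := funext fun w => (orthoPoly_threeTerm _).zero
    exact ⟨0, e ▸ HasCoeffDerivAt.const 1⟩
  | 1 =>
    obtain ⟨D, hD⟩ := ih 0 one_pos
    have hA := (differentiableAt_recA_of hβ hz hD).hasDerivAt
    have e : charlierPoly β 1 = fun w => X - C (recA (momentFunctional β w) 0) :=
      funext fun w => (orthoPoly_threeTerm _).one
    rw [e]
    exact ⟨_, (HasCoeffDerivAt.const X).sub (.of_C hA)⟩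
  | n + 2 =>
    obtain ⟨D, hD⟩ := ih n (by omega)
    obtain ⟨D', hD'⟩ := ih (n + 1) (by omega)
    have hA := (differentiableAt_recA_of hβ hz hD').hasDerivAt
    have hB := (differentiableAt_recB_of hβ hz hD hD').hasDerivAt
    have e : charlierPoly β (n + 2) = fun w =>
        (X - C (recA (momentFunctional β w) (n + 1))) * charlierPoly β (n + 1) w
          - C (recB (momentFunctional β w) (n + 1)) * charlierPoly β n w :=
      funext fun w => (orthoPoly_threeTerm _).step n
    rw [e]
    exact ⟨_, (((HasCoeffDerivAt.const X).sub (.of_C hA)).mul hD').sub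
      ((HasCoeffDerivAt.of_C hB).mul hD)⟩

/-- The `z`-derivative of a monic family has smaller degree, hence is orthogonal to `P_n`. -/
lemma HasCoeffDerivAt.coeff_charlierPoly {n : ℕ} {D : ℝ[X]}
    (h : HasCoeffDerivAt (charlierPoly β n) D z) : D.natDegree ≤ n ∧ D.coeff n = 0 := by
  refine ⟨h.natDegree_le fun w => orthoPoly_natDegree_le _ _, ?_⟩
  have h1 := h n
  simp only [charlierPoly, orthoPoly_coeff_self] at h1
  exact h1.unique (hasDerivAt_const z 1)

/-- First Toda equation: `z h_n' = α_n h_n`. -/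
theorem hasDerivAt_sqNorm (hβ : -1 < β) (hz : 0 < z) (n : ℕ) :
    HasDerivAt (fun w => sqNorm (momentFunctional β w) n)
      (recA (momentFunctional β z) n * sqNorm (momentFunctional β z) n / z) z := by
  obtain ⟨D, hD⟩ := exists_hasCoeffDerivAt_charlierPoly hβ hz n
  have hL := fun p hp => momentFunctional_mul_self_pos hβ hz p hp
  refine (hasDerivAt_sqNorm_of hβ hz hD).congr_deriv ?_
  obtain ⟨d1, d2⟩ := hD.coeff_charlierPoly
  rw [mul_comm D, map_add, map_orthoPoly_mul hL n D d1, d2, recA,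
    div_mul_cancel₀ _ (sqNorm_pos hL n).ne']
  ring

/-- Second Toda equation, summed: `z S_n' = b_n` for `S_n = ∑_{k<n} α_k`, obtained by
differentiating the orthogonality of `P_n` and `P_{n-1}`. -/
theorem hasDerivAt_sum_recA (hβ : -1 < β) (hz : 0 < z) (n : ℕ) :
    HasDerivAt (fun w => ∑ k ∈ range n, recA (momentFunctional β w) k)
      (recB (momentFunctional β z) n / z) z := by
  rcases n with _ | n
  · simpa [recB] using hasDerivAt_const z (0 : ℝ)
  have hL := fun p hp => momentFunctional_mul_self_pos hβ hz p hp
  obtain ⟨D, hD⟩ := exists_hasCoeffDerivAt_charlierPoly hβ hz n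
  obtain ⟨D', hD'⟩ := exists_hasCoeffDerivAt_charlierPoly hβ hz (n + 1)
  obtain ⟨d1, d2⟩ := hD.coeff_charlierPoly
  obtain ⟨d1', d2'⟩ := hD'.coeff_charlierPoly
  have hS : HasDerivAt (fun w => ∑ k ∈ range (n + 1), recA (momentFunctional β w) k)
      (-D'.coeff n) z := by
    have := (hD' n).neg
    refine this.congr_of_eventuallyEq (Filter.Eventually.of_forall fun w => ?_)
    simp [(orthoPoly_threeTerm (momentFunctional β w)).coeff_sub_one rfl]
  refine hS.congr_deriv ?_
  have hd := (hD'.mul hD).momentFunctional hβ hz (N := n + 1 + n) fun w => natDegree_mul_le.trans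
    (add_le_add (orthoPoly_natDegree_le _ _) (orthoPoly_natDegree_le _ _))
  have h0 : (fun w => momentFunctional β w (charlierPoly β (n + 1) w * charlierPoly β n w))
      =ᶠ[nhds z] fun _ => 0 := by
    filter_upwards [Ioi_mem_nhds hz] with w hw
    rw [map_orthoPoly_mul (fun p hp => momentFunctional_mul_self_pos hβ hw p hp) _ _
      ((orthoPoly_natDegree_le _ _).trans (by omega)), coeff_eq_zero_of_natDegree_lt
      (Nat.lt_succ_of_le (orthoPoly_natDegree_le _ _)), zero_mul]
  have e := (hd.congr_of_eventuallyEq h0.symm).unique (hasDerivAt_const z 0)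
  have hX : (X * charlierPoly β n z).natDegree ≤ n + 1 := natDegree_mul_le.trans (by
    have : (charlierPoly β n z).natDegree ≤ n := orthoPoly_natDegree_le _ n
    rw [natDegree_X]; omega)
  rw [map_add, mul_comm D', map_orthoPoly_mul hL n D' (natDegree_le_of_coeff_eq_zero d1' d2'),
    map_orthoPoly_mul hL (n + 1) D (by omega), coeff_eq_zero_of_natDegree_lt (p := D) (by omega),
    mul_left_comm, map_orthoPoly_mul hL (n + 1) _ hX, coeff_X_mul, orthoPoly_coeff_self] at e
  have hn := (sqNorm_pos hL n).ne'
  rw [recB]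
  field_simp at e ⊢
  linarith

/-- `z b_n' = b_n (α_n - α_{n-1})`, with `α_{n-1}` eliminated by means of the first
Laguerre–Freud equation so that `n = 0` is covered. -/
theorem hasDerivAt_recB (hβ : -1 < β) (hz : 0 < z) (n : ℕ) :
    HasDerivAt (fun w => recB (momentFunctional β w) n)
      ((recB (momentFunctional β z) n * (2 * recA (momentFunctional β z) n + β - n + 1) - z * n)
        / z) z := by
  rcases n with _ | n
  · simpa [recB] using hasDerivAt_const z (0 : ℝ)
  have hL := fun p hp => momentFunctional_mul_self_pos hβ hz p hp
  have hn := (sqNorm_pos hL n).ne'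
  refine ((hasDerivAt_sqNorm hβ hz (n + 1)).div (hasDerivAt_sqNorm hβ hz n) hn).congr_deriv ?_
  have e := laguerreFreud_one hL (pearson_momentFunctional hβ z) n
  push_cast
  rw [show recB (momentFunctional β z) (n + 1) * (2 * recA (momentFunctional β z) (n + 1) + β
      - ((n : ℝ) + 1) + 1) - z * (n + 1) = recB (momentFunctional β z) (n + 1) *
      (recA (momentFunctional β z) (n + 1) - recA (momentFunctional β z) n) by
    linear_combination e, recB]
  field_simp

/-! ### The second-order equations -/

lemma momentFunctional_X_pow (β z : ℝ) (m : ℕ) : momentFunctional β z (X ^ m) = moment β z m := by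
  rw [momentFunctional_eq_sum β z (natDegree_X_pow_le m)]
  simp [coeff_X_pow]

lemma Delta_eq_prod (hβ : -1 < β) (hz : 0 < z) (n : ℕ) :
    Delta n β z = ∏ k ∈ range n, sqNorm (momentFunctional β z) k := by
  rw [Delta_eq_det hβ hz, ← det_hankel_eq_prod (momentFunctional_mul_self_pos hβ hz)]
  simp only [momentFunctional_X_pow]

lemma Delta_pos (hβ : -1 < β) (hz : 0 < z) (n : ℕ) : 0 < Delta n β z := by
  rw [Delta_eq_prod hβ hz]
  exact prod_pos fun k _ => sqNorm_pos (momentFunctional_mul_self_pos hβ hz) k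

lemma hasDerivAt_log_Delta (hβ : -1 < β) (hz : 0 < z) (n : ℕ) :
    HasDerivAt (fun w => Real.log (Delta n β w))
      ((∑ k ∈ range n, recA (momentFunctional β z) k) / z) z := by
  have h : HasDerivAt (fun w => ∑ k ∈ range n, Real.log (sqNorm (momentFunctional β w) k))
      ((∑ k ∈ range n, recA (momentFunctional β z) k) / z) z := by
    rw [sum_div]
    refine HasDerivAt.fun_sum fun k _ => ?_
    have hk := (sqNorm_pos (momentFunctional_mul_self_pos hβ hz) k).ne'
    exact ((hasDerivAt_sqNorm hβ hz k).log hk).congr_deriv (by field_simp)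
  refine h.congr_of_eventuallyEq ?_
  filter_upwards [Ioi_mem_nhds hz] with w hw
  rw [Delta_eq_prod hβ hw, Real.log_prod fun k _ =>
    (sqNorm_pos (momentFunctional_mul_self_pos hβ hw) k).ne']

lemma differentiableAt_Delta (hβ : -1 < β) (hz : 0 < z) (n : ℕ) :
    DifferentiableAt ℝ (Delta n β) z := by
  refine (hasDerivAt_log_Delta hβ hz n).exp.differentiableAt.congr_of_eventuallyEq ?_
  filter_upwards [Ioi_mem_nhds hz] with w hw
  rw [Real.exp_log (Delta_pos hβ hw n)]

lemma S_eq_sum (hβ : -1 < β) (hz : 0 < z) (n : ℕ) :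
    S n β z = ∑ k ∈ range n, recA (momentFunctional β z) k := by
  rw [S, euler, (hasDerivAt_log_Delta hβ hz n).deriv, mul_div_cancel₀ _ hz.ne']

lemma hasDerivAt_S (hβ : -1 < β) (hz : 0 < z) (n : ℕ) :
    HasDerivAt (S n β) (recB (momentFunctional β z) n / z) z := by
  refine (hasDerivAt_sum_recA hβ hz n).congr_of_eventuallyEq ?_
  filter_upwards [Ioi_mem_nhds hz] with w hw using S_eq_sum hβ hw n

lemma hasDerivAt_deriv_S (hβ : -1 < β) (hz : 0 < z) (n : ℕ) :
    HasDerivAt (deriv (S n β))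
      ((recB (momentFunctional β z) n * (2 * recA (momentFunctional β z) n + β - n) - z * n)
        / z ^ 2) z := by
  have h := ((hasDerivAt_recB hβ hz n).div (hasDerivAt_id z) hz.ne').congr_of_eventuallyEq
    (f₁ := deriv (S n β)) (by
      filter_upwards [Ioi_mem_nhds hz] with w hw using (hasDerivAt_S hβ hw n).deriv)
  refine h.congr_deriv ?_
  simp only [id]
  field_simp
  ring

theorem solvesSEquation_S (hβ : -1 < β) (n : ℕ) : SolvesSEquation n β (S n β) := by
  refine ⟨fun z hz => ⟨(hasDerivAt_S hβ hz n).differentiableAt,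
    (hasDerivAt_deriv_S hβ hz n).differentiableAt⟩, fun z hz => ?_⟩
  have hI := first_integral (fun p hp => momentFunctional_mul_self_pos hβ hz p hp)
    (pearson_momentFunctional hβ z) n
  rw [(hasDerivAt_deriv_S hβ hz n).deriv, (hasDerivAt_S hβ hz n).deriv, S_eq_sum hβ hz]
  set b := recB (momentFunctional β z) n
  set a := recA (momentFunctional β z) n
  field_simp
  linear_combination -8 * b * hI

/-- The affine shift changes the derivative by `-1/2` and nothing else; the two equations then
agree by algebra. -/
theorem solvesSEquation_iff_shift (n : ℕ) (β : ℝ) (f : ℝ → ℝ) :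
    SolvesSEquation n β f ↔ SolvesPIIIPrimeSigma (n + β) (n - β) (shift n β f) := by
  have hg : shift n β f = fun z => f z + (-(1 / 2) * z
      + (-(n : ℝ) ^ 2 / 4 + (n : ℝ) * (β + 1) / 2 + β ^ 2 / 4)) := by
    funext z; rw [shift]; ring
  have hlin : ∀ z : ℝ, HasDerivAt (fun z : ℝ => -(1 / 2) * z
      + (-(n : ℝ) ^ 2 / 4 + (n : ℝ) * (β + 1) / 2 + β ^ 2 / 4)) (-(1 / 2)) z := fun z => by
    simpa using ((hasDerivAt_id z).const_mul (-(1 / 2) : ℝ)).add_const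
      (-(n : ℝ) ^ 2 / 4 + (n : ℝ) * (β + 1) / 2 + β ^ 2 / 4)
  have hdiff : ∀ z, DifferentiableAt ℝ (shift n β f) z ↔ DifferentiableAt ℝ f z := fun z => by
    rw [hg]; exact (hlin z).differentiableAt.fun_add_iff_left
  have hd : ∀ z, DifferentiableAt ℝ f z → deriv (shift n β f) z = deriv f z + -(1 / 2) :=
    fun z hz => by rw [hg]; exact (hz.hasDerivAt.add (hlin z)).deriv
  have hev : ∀ z, 0 < z → (∀ w, 0 < w → DifferentiableAt ℝ f w) →
      deriv (shift n β f) =ᶠ[nhds z] fun w => deriv f w + -(1 / 2) := fun z hz h => by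
    filter_upwards [Ioi_mem_nhds hz] with w hw using hd w (h w hw)
  have hT : TwiceDiff f ↔ TwiceDiff (shift n β f) := by
    have key : ∀ z, 0 < z → (∀ w, 0 < w → DifferentiableAt ℝ f w) →
        (DifferentiableAt ℝ (deriv (shift n β f)) z ↔ DifferentiableAt ℝ (deriv f) z) :=
      fun z hz h => by
        rw [(hev z hz h).differentiableAt_iff]
        exact (differentiableAt_const _).fun_add_iff_left
    constructor
    · intro h z hz
      exact ⟨(hdiff z).2 (h z hz).1, (key z hz fun w hw => (h w hw).1).2 (h z hz).2⟩
    · intro h z hz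
      exact ⟨(hdiff z).1 (h z hz).1,
        (key z hz fun w hw => (hdiff w).1 (h w hw).1).1 (h z hz).2⟩
  rw [SolvesSEquation, SolvesPIIIPrimeSigma, ← hT]
  refine and_congr_right fun h => forall_congr' fun z => forall_congr' fun hz => ?_
  have h1 := fun w hw => (h w hw).1
  rw [(hev z hz h1).deriv_eq, deriv_add_const, hd z (h1 z hz), shift]
  constructor <;> intro e <;> linear_combination e

end GenCharlier

theorem theorem4p4 (n : ℕ) (β : ℝ) (hβ : -1 < β) :
    -- `Δ_n` is the Hankel determinant of the (finite) moments of the weight, and is positive and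
    -- differentiable, so that `S_n` is well defined
    (∀ z : ℝ, 0 < z →
      (∀ m : ℕ, Summable fun k : ℕ => (k : ℝ) ^ m * GenCharlier.weight β z k) ∧
      GenCharlier.Delta n β z =
        (Matrix.of fun i j : Fin n => GenCharlier.moment β z ((i : ℕ) + (j : ℕ))).det ∧
      0 < GenCharlier.Delta n β z ∧
      DifferentiableAt ℝ (GenCharlier.Delta n β) z) ∧
    -- `S_n` satisfies the second-order, second-degree equation
    GenCharlier.SolvesSEquation n β (GenCharlier.S n β) ∧
    -- under the affine shift this equation is the P_III' σ-equation
    (∀ f : ℝ → ℝ, GenCharlier.SolvesSEquation n β f ↔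
      GenCharlier.SolvesPIIIPrimeSigma (n + β) (n - β) (GenCharlier.shift n β f)) ∧
    GenCharlier.SolvesPIIIPrimeSigma (n + β) (n - β)
      (GenCharlier.shift n β (GenCharlier.S n β)) := by
  exact ⟨fun z hz => ⟨GenCharlier.summable_pow_mul_weight hβ z, GenCharlier.Delta_eq_det hβ hz n,
      GenCharlier.Delta_pos hβ hz n, GenCharlier.differentiableAt_Delta hβ hz n⟩,
    GenCharlier.solvesSEquation_S hβ n, GenCharlier.solvesSEquation_iff_shift n β,
    (GenCharlier.solvesSEquation_iff_shift n β _).1 (GenCharlier.solvesSEquation_S hβ n)⟩
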